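/- Let $n \ge 2$ and, for $X=(x_1,\dots,x_n),\ Y=(y_1,\dots,y_n) \in \mathbb{C}^n$, put $\varphi_n(X,Y)=\sum_{i=1}^n (x_i-y_i)^2 \in \mathbb{C}$. A map $f:\mathbb{C}^n\to\mathbb{C}^n$ is said to preserve the distance $d\in\mathbb{C}$ if for all $X,Y\in\mathbb{C}^n$, $\varphi_n(X,Y)=d^2$ implies $\varphi_n(f(X),f(Y))=d^2$. Let $d_1,d_2\in\mathbb{C}\setminus\{0\}$ with $d_1^2/d_2^2\notin\mathbb{R}$, and let $f:\mathbb{C}^n\to\mathbb{C}^n$ be a continuous map that preserves both distances $d_1$ and $d_2$. Then $f$ is a $\mathbb{C}$-affine mapping with orthogonal linear part, that is, $f(X)=L(X)+b$ for all $X\in\mathbb{C}^n$, where $b\in\mathbb{C}^n$ and $L:\mathbb{C}^n\to\mathbb{C}^n$ is a $\mathbb{C}$-linear map whose matrix $A$ in the standard basis satisfies $A^{T}A=\mathrm{Id}$ (equivalently, $L$ preserves the bilinear form $(x,y)\mapsto\sum_{i=1}^n x_iy_i$). -/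

import Mathlib

/-- `φₙ(X, Y) = ∑ᵢ (xᵢ - yᵢ)²` on `ℂⁿ` (no complex conjugation). -/
def phi {n : ℕ} (X Y : Fin n → ℂ) : ℂ :=
  ∑ i, (X i - Y i) ^ 2

/-- `f : ℂⁿ → ℂⁿ` preserves the distance `d ∈ ℂ`. -/
def PreservesDistance {n : ℕ} (f : (Fin n → ℂ) → (Fin n → ℂ)) (d : ℂ) : Prop :=
  ∀ X Y : Fin n → ℂ, phi X Y = d ^ 2 → phi (f X) (f Y) = d ^ 2

/-- A `ℂ`-linear endomorphism of `ℂⁿ` is (complex) orthogonal if its matrix in the standard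
basis lies in the complex orthogonal group, i.e. `Aᵀ * A = 1` (not the unitary group). -/
def IsOrthogonalMap {n : ℕ} (L : (Fin n → ℂ) →ₗ[ℂ] (Fin n → ℂ)) : Prop :=
  LinearMap.toMatrix' L ∈ Matrix.orthogonalGroup (Fin n) ℂ

/-- `f : ℂⁿ → ℂⁿ` is a `ℂ`-affine mapping with orthogonal linear part. -/
def IsAffineWithOrthogonalLinearPart {n : ℕ} (f : (Fin n → ℂ) → (Fin n → ℂ)) : Prop :=
  ∃ g : (Fin n → ℂ) →ᵃ[ℂ] (Fin n → ℂ), (∀ X, g X = f X) ∧ IsOrthogonalMap g.linear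

open Matrix

/-! A complex homothety reduces to a map preserving the values `1` and `σ ^ 2` of `phi`, with `σ ^
2` nonreal.

The value `1` alone yields all positive real values. The points at a given value of `phi` from all
vertices of a regular simplex with `n - 1` vertices form a complex circle parametrized by `ℂ \ {0}`,
which is mapped into a congruent circle. By connectedness the induced map of parameters commutes
with the rotation of chord `1`, up to inverting that rotation, so the chords of all multiples of its
angle are preserved. Niven's theorem makes a suitable such angle incommensurable with `2π`; density
and continuity do the rest (`preservesPhi_of_mem_closure`, `preservesPhi_of_pos`).

Hence `f` is affine and isometric on `ℝⁿ` and on its rigid images. This determines `f` on Lorentzian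
planes, so `-1` is preserved and `f` is affine in imaginary directions as well. What remains is `f 0
+ G x + I • H y + (x ⬝ᵥ y) • D` with `Gᵀ * H` scalar (`exists_biaffine_form`). Complex conjugation
shows that the value `1` cannot give more than real linearity; the value `σ ^ 2` forces `D = 0` and
`H = G`. -/

/-! ### Rigid motions and homotheties. -/

/-- `f` preserves the value `s` of the quadratic form `phi`. -/
def PreservesPhi {n : ℕ} (f : (Fin n → ℂ) → (Fin n → ℂ)) (s : ℂ) : Prop :=
  ∀ X Y : Fin n → ℂ, phi X Y = s → phi (f X) (f Y) = s

theorem phi_eq_dotProduct {n : ℕ} (X Y : Fin n → ℂ) : phi X Y = (X - Y) ⬝ᵥ (X - Y) := by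
  simp [phi, dotProduct, sq]

theorem phi_expand {n : ℕ} (X Y : Fin n → ℂ) :
    phi X Y = X ⬝ᵥ X + Y ⬝ᵥ Y - 2 * (X ⬝ᵥ Y) := by
  rw [phi_eq_dotProduct, sub_dotProduct, dotProduct_sub, dotProduct_sub, dotProduct_comm Y X]
  ring

theorem mulVec_dotProduct_mulVec_of_orthogonal {n : ℕ} {M : Matrix (Fin n) (Fin n) ℂ}
    (hM : Mᵀ * M = 1) (x y : Fin n → ℂ) : (M *ᵥ x) ⬝ᵥ (M *ᵥ y) = x ⬝ᵥ y := by
  rw [dotProduct_mulVec, ← mulVec_transpose, mulVec_mulVec, hM, one_mulVec]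

theorem phi_rigid {n : ℕ} {M : Matrix (Fin n) (Fin n) ℂ} (hM : Mᵀ * M = 1)
    (p X Y : Fin n → ℂ) : phi (p + M *ᵥ X) (p + M *ᵥ Y) = phi X Y := by
  rw [phi_eq_dotProduct, add_sub_add_left_eq_sub, ← mulVec_sub,
    mulVec_dotProduct_mulVec_of_orthogonal hM, phi_eq_dotProduct]

theorem PreservesPhi.comp_rigid {n : ℕ} {f : (Fin n → ℂ) → (Fin n → ℂ)} {s : ℂ}
    (h : PreservesPhi f s) {M : Matrix (Fin n) (Fin n) ℂ} (hM : Mᵀ * M = 1) (p : Fin n → ℂ) :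
    PreservesPhi (fun X => f (p + M *ᵥ X)) s := fun X Y hXY =>
  h _ _ (by rw [phi_rigid hM, hXY])

/-- The factor `c` may be any nonzero complex number: real factors enlarge the range of known
values, `c = I` exchanges `1` and `-1`, and `c = σ` exploits the nonreal value. -/
theorem PreservesPhi.rescale {n : ℕ} {f : (Fin n → ℂ) → (Fin n → ℂ)} {s c : ℂ} (hc : c ≠ 0)
    (h : PreservesPhi f (c ^ 2 * s)) : PreservesPhi (fun X => c⁻¹ • f (c • X)) s := by
  intro X Y hXY
  have key : ∀ (k : ℂ) (U V : Fin n → ℂ), phi (k • U) (k • V) = k ^ 2 * phi U V := by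
    intro k U V
    simp only [phi, Pi.smul_apply, smul_eq_mul, Finset.mul_sum]
    exact Finset.sum_congr rfl fun i _ => by ring
  rw [key, h _ _ (by rw [key, hXY])]
  field_simp

theorem PreservesPhi.of_rescale {n : ℕ} {f : (Fin n → ℂ) → (Fin n → ℂ)} {s c : ℂ} (hc : c ≠ 0)
    (h : PreservesPhi (fun X => c⁻¹ • f (c • X)) s) : PreservesPhi f (c ^ 2 * s) := by
  have h' := PreservesPhi.rescale (f := fun X => c⁻¹ • f (c • X)) (s := c ^ 2 * s)
    (inv_ne_zero hc) (by
      have : (c⁻¹) ^ 2 * (c ^ 2 * s) = s := by field_simp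
      rw [this]; exact h)
  simpa [smul_smul, hc] using h'

/-! ### Extension of orthonormal families and congruence of simplices. -/

/-- A family that is orthonormal for the bilinear form extends to an orthogonal matrix. -/
theorem exists_orthogonal_of_orthonormalOn {n : ℕ} (s : Finset (Fin n))
    (o : Fin n → Fin n → ℂ)
    (ho : ∀ i ∈ s, ∀ j ∈ s, o i ⬝ᵥ o j = if i = j then 1 else 0) :
    ∃ M : Matrix (Fin n) (Fin n) ℂ, Mᵀ * M = 1 ∧ ∀ i ∈ s, M *ᵥ Pi.single i 1 = o i := by
  induction hk : n - s.card generalizing s o with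
  | zero =>
    have hs : s = Finset.univ := by
      apply Finset.eq_univ_of_card
      have := Finset.card_le_univ s
      simp at this ⊢; omega
    subst hs
    refine ⟨Matrix.of fun i j => o j i, ?_, ?_⟩
    · ext i j
      simpa [Matrix.mul_apply, dotProduct, Matrix.one_apply] using
        ho i (Finset.mem_univ _) j (Finset.mem_univ _)
    · intro i _
      ext j
      simp
  | succ k ih =>
    have hlt : s.card < n := by omega
    obtain ⟨j, hj⟩ : ∃ j, j ∉ s := by
      by_contra hcon
      push Not at hcon
      have : s = Finset.univ := Finset.eq_univ_iff_forall.2 hcon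
      simp [this] at hlt
    -- The columns of the projection `1 - ∑ o q (o q)ᵀ`. It is symmetric and idempotent, so `x l ⬝ᵥ
    -- x l` is a diagonal entry; the trace `n - s.card` is nonzero, so some column is not isotropic.
    let x : Fin n → Fin n → ℂ := fun l => Pi.single l 1 - ∑ q ∈ s, o q l • o q
    have hxo : ∀ l, ∀ i ∈ s, o i ⬝ᵥ x l = 0 := by
      intro l i hi
      simp only [x, dotProduct_sub, dotProduct_sum, dotProduct_smul, smul_eq_mul]
      rw [Finset.sum_congr rfl fun q hq => by rw [ho i hi q hq]]
      simp [hi]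
    have hxx : ∀ l, x l ⬝ᵥ x l = x l l := by
      intro l
      have : x l ⬝ᵥ x l = (Pi.single l 1 - ∑ q ∈ s, o q l • o q) ⬝ᵥ x l := rfl
      rw [this, sub_dotProduct, sum_dotProduct]
      rw [Finset.sum_eq_zero fun q hq => by rw [smul_dotProduct, hxo l q hq, smul_zero]]
      simp
    obtain ⟨l, hl⟩ : ∃ l, x l l ≠ 0 := by
      by_contra hcon
      push Not at hcon
      have h1 : ∑ l, x l l = (n : ℂ) - s.card := by
        simp only [x, Pi.sub_apply, Pi.single_eq_same, Finset.sum_apply, Pi.smul_apply,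
          smul_eq_mul, Finset.sum_sub_distrib]
        rw [Finset.sum_comm]
        have : ∀ q ∈ s, ∑ l, o q l * o q l = 1 := fun q hq => by
          simpa [dotProduct] using ho q hq q hq
        rw [Finset.sum_congr rfl this]
        simp
      rw [Finset.sum_eq_zero fun l _ => hcon l] at h1
      have : (n : ℂ) = s.card := by linear_combination -h1
      have : n = s.card := by exact_mod_cast this
      omega
    obtain ⟨c, hc⟩ := IsAlgClosed.exists_pow_nat_eq (x l l) (n := 2) two_pos
    have hc0 : c ≠ 0 := by
      rintro rfl
      exact hl (by rw [← hc]; ring)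
    have hne : ∀ i ∈ s, i ≠ j := fun i hi h => hj (h ▸ hi)
    obtain ⟨M, hM, hMo⟩ := ih (insert j s) (Function.update o j (c⁻¹ • x l)) (by
      intro a ha b hb
      rcases Finset.mem_insert.1 ha with rfl | ha' <;>
        rcases Finset.mem_insert.1 hb with rfl | hb'
      · simp only [Function.update_self, smul_dotProduct, dotProduct_smul, hxx, ← hc, if_true,
          smul_eq_mul]
        field_simp
      · rw [Function.update_self, Function.update_of_ne (hne b hb'), dotProduct_comm,
          dotProduct_smul, hxo l b hb', if_neg (hne b hb').symm, smul_zero]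
      · rw [Function.update_self, Function.update_of_ne (hne a ha'),
          dotProduct_smul, hxo l a ha', if_neg (hne a ha'), smul_zero]
      · rw [Function.update_of_ne (hne a ha'), Function.update_of_ne (hne b hb')]
        exact ho a ha' b hb') (by rw [Finset.card_insert_of_notMem hj]; omega)
    refine ⟨M, hM, fun i hi => ?_⟩
    rw [hMo i (Finset.mem_insert_of_mem hi), Function.update_of_ne (hne i hi)]

theorem exists_orthogonal_mulVec_single {n : ℕ} (i : Fin n) {v : Fin n → ℂ} (hv : v ⬝ᵥ v = 1) :
    ∃ M : Matrix (Fin n) (Fin n) ℂ, Mᵀ * M = 1 ∧ M *ᵥ Pi.single i 1 = v := by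
  obtain ⟨M, hM, h⟩ := exists_orthogonal_of_orthonormalOn {i} (fun _ => v) (by
    intro a ha b hb
    rw [Finset.mem_singleton.1 ha, Finset.mem_singleton.1 hb, if_pos rfl, hv])
  exact ⟨M, hM, h i (Finset.mem_singleton_self i)⟩

/-- The orthogonal group acts transitively on vectors of a given nonzero square. -/
theorem exists_orthogonal_mulVec_eq {n : ℕ} {v w : Fin n → ℂ} (hv : v ⬝ᵥ v ≠ 0)
    (hvw : v ⬝ᵥ v = w ⬝ᵥ w) :
    ∃ M : Matrix (Fin n) (Fin n) ℂ, Mᵀ * M = 1 ∧ M *ᵥ v = w := by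
  obtain ⟨i⟩ : Nonempty (Fin n) := by
    by_contra h
    rw [not_nonempty_iff] at h
    exact hv (by simp [dotProduct])
  obtain ⟨c, hc⟩ := IsAlgClosed.exists_pow_nat_eq (v ⬝ᵥ v) (n := 2) two_pos
  have hc0 : c ≠ 0 := by
    rintro rfl
    exact hv (by rw [← hc]; ring)
  obtain ⟨A, hA, hAv⟩ := exists_orthogonal_mulVec_single i (v := c⁻¹ • v) (by
    rw [smul_dotProduct, dotProduct_smul, ← hc, smul_eq_mul, smul_eq_mul]; field_simp)
  obtain ⟨B, hB, hBw⟩ := exists_orthogonal_mulVec_single i (v := c⁻¹ • w) (by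
    rw [smul_dotProduct, dotProduct_smul, ← hvw, ← hc, smul_eq_mul, smul_eq_mul]; field_simp)
  refine ⟨B * Aᵀ, ?_, ?_⟩
  · rw [transpose_mul, transpose_transpose, Matrix.mul_assoc, ← Matrix.mul_assoc Bᵀ, hB,
      Matrix.one_mul, mul_eq_one_comm.1 hA]
  · have h1 : Aᵀ *ᵥ (c⁻¹ • v) = Pi.single i 1 := by
      rw [← hAv, mulVec_mulVec, hA, one_mulVec]
    have h2 : (B * Aᵀ) *ᵥ (c⁻¹ • v) = c⁻¹ • w := by
      rw [← mulVec_mulVec, h1, hBw]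
    rw [mulVec_smul] at h2
    exact smul_right_injective _ (inv_ne_zero hc0) h2

/-- Points with all mutual values of `phi` equal to `1` are congruent to the points
`κ • Pi.single i 1` with `κ ^ 2 = 1 / 2`. -/
theorem exists_rigid_of_regular_simplex {n : ℕ} {s : Finset (Fin n)} (hs : s.Nonempty)
    {κ : ℂ} (hκ : κ ^ 2 = 1 / 2) (y : Fin n → Fin n → ℂ)
    (hy : ∀ i ∈ s, ∀ j ∈ s, i ≠ j → phi (y i) (y j) = 1) :
    ∃ (p : Fin n → ℂ) (M : Matrix (Fin n) (Fin n) ℂ), Mᵀ * M = 1 ∧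
      ∀ i ∈ s, y i = p + M *ᵥ Pi.single i κ := by
  have hκ0 : κ ≠ 0 := by rintro rfl; norm_num at hκ
  obtain ⟨m, hm⟩ : ∃ m : ℂ, m = s.card := ⟨_, rfl⟩
  have hm0 : m ≠ 0 := by
    rw [hm]; exact_mod_cast hs.card_pos.ne'
  let c : Fin n → ℂ := m⁻¹ • ∑ i ∈ s, y i
  let z : Fin n → Fin n → ℂ := fun i => y i - c
  have hz0 : ∑ i ∈ s, z i = 0 := by
    simp only [z, c, Finset.sum_sub_distrib, Finset.sum_const]
    rw [← Nat.cast_smul_eq_nsmul ℂ, ← hm, smul_smul, mul_inv_cancel₀ hm0, one_smul, sub_self]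
  have hzz : ∀ i ∈ s, ∀ j ∈ s,
      2 * (z i ⬝ᵥ z j) = z i ⬝ᵥ z i + z j ⬝ᵥ z j - 1 + if i = j then 1 else 0 := by
    intro i hi j hj
    split_ifs with h
    · subst h; ring
    · have h1 := hy i hi j hj h
      have h2 : phi (y i) (y j) = phi (z i) (z j) := by
        rw [phi_eq_dotProduct, phi_eq_dotProduct]; simp [z]
      rw [h2, phi_expand] at h1
      linear_combination -h1
  have hN : ∀ i ∈ s, m * (z i ⬝ᵥ z i) + ∑ j ∈ s, z j ⬝ᵥ z j - m + 1 = 0 := by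
    intro i hi
    have h1 : ∑ j ∈ s, 2 * (z i ⬝ᵥ z j) = 0 := by
      rw [← Finset.mul_sum, ← dotProduct_sum, hz0, dotProduct_zero, mul_zero]
    rw [Finset.sum_congr rfl (hzz i hi)] at h1
    simpa [Finset.sum_add_distrib, Finset.sum_sub_distrib, hi, ← hm] using h1
  have hS : ∑ j ∈ s, z j ⬝ᵥ z j = (m - 1) / 2 := by
    have h1 := Finset.sum_eq_zero hN
    simp only [Finset.sum_add_distrib, Finset.sum_sub_distrib, ← Finset.mul_sum, Finset.sum_const,
      nsmul_eq_mul, ← hm, mul_one] at h1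
    have h2 : m * (2 * (∑ j ∈ s, z j ⬝ᵥ z j) - (m - 1)) = 0 := by linear_combination h1
    rcases mul_eq_zero.1 h2 with h | h
    · exact absurd h hm0
    · linear_combination h / 2
  have hNi : ∀ i ∈ s, z i ⬝ᵥ z i = (m - 1) / (2 * m) := by
    intro i hi
    have h1 := hN i hi
    rw [hS] at h1
    field_simp
    linear_combination 2 * h1
  have hG : ∀ i ∈ s, ∀ j ∈ s, 2 * (z i ⬝ᵥ z j) = (if i = j then 1 else 0) - 1 / m := by
    intro i hi j hj
    rw [hzz i hi j hj, hNi i hi, hNi j hj]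
    field_simp
    ring
  -- By `hG` and `∑ z = 0`, the matrix `∑ 2 z q (z q)ᵀ` fixes every `z i`. Its complementary
  -- projection has trace `n - (m - 1) ≠ 0`, which again provides a non-isotropic column orthogonal
  -- to all `z i`.
  let x : Fin n → Fin n → ℂ := fun l => Pi.single l 1 - ∑ q ∈ s, (2 * z q l) • z q
  have hzx : ∀ l, ∀ i ∈ s, z i ⬝ᵥ x l = 0 := by
    intro l i hi
    simp only [x, dotProduct_sub, dotProduct_sum, dotProduct_smul, smul_eq_mul]
    have h1 : ∀ q ∈ s, 2 * z q l * (z i ⬝ᵥ z q) = z q l * (if i = q then 1 else 0) -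
        z q l * (1 / m) := by
      intro q hq
      linear_combination z q l * hG i hi q hq
    rw [Finset.sum_congr rfl h1, Finset.sum_sub_distrib, ← Finset.sum_mul, ← Finset.sum_apply, hz0]
    simp [hi]
  have hxx : ∀ l, x l ⬝ᵥ x l = x l l := by
    intro l
    have : x l ⬝ᵥ x l = (Pi.single l 1 - ∑ q ∈ s, (2 * z q l) • z q) ⬝ᵥ x l := rfl
    rw [this, sub_dotProduct, sum_dotProduct]
    rw [Finset.sum_eq_zero fun q hq => by rw [smul_dotProduct, hzx l q hq, smul_zero]]
    simp
  obtain ⟨l, hl⟩ : ∃ l, x l l ≠ 0 := by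
    by_contra hcon
    push Not at hcon
    have h1 : ∑ l, x l l = (n : ℂ) - 2 * ∑ q ∈ s, z q ⬝ᵥ z q := by
      simp only [x, Pi.sub_apply, Pi.single_eq_same, Finset.sum_apply, Pi.smul_apply,
        smul_eq_mul, Finset.sum_sub_distrib]
      rw [Finset.sum_comm, Finset.mul_sum]
      simp [dotProduct, Finset.mul_sum, mul_assoc]
    rw [Finset.sum_eq_zero fun l _ => hcon l, hS, hm] at h1
    have h2 : (n : ℂ) + 1 = s.card := by linear_combination -h1
    have h3 : n + 1 = s.card := by exact_mod_cast h2
    have := Finset.card_le_univ s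
    simp at this
    omega
  -- Adding a common orthogonal vector of square `1 / (2 * m)` turns the Gram matrix `(δ - 1 / m) /
  -- 2` into `δ / 2`, that of the points `Pi.single i κ`.
  obtain ⟨r, hr⟩ := IsAlgClosed.exists_pow_nat_eq (1 / (2 * m * x l l)) (n := 2) two_pos
  have hu : (r • x l) ⬝ᵥ (r • x l) = 1 / (2 * m) := by
    rw [smul_dotProduct, dotProduct_smul, hxx, smul_eq_mul, smul_eq_mul, ← mul_assoc, ← sq, hr]
    field_simp
  obtain ⟨M, hM, hMo⟩ := exists_orthogonal_of_orthonormalOn s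
    (fun i => κ⁻¹ • (z i + r • x l)) (by
      intro i hi j hj
      have h1 : (z i + r • x l) ⬝ᵥ (z j + r • x l) = z i ⬝ᵥ z j + 1 / (2 * m) := by
        rw [add_dotProduct, dotProduct_add, dotProduct_add, hu, dotProduct_smul, hzx l i hi,
          dotProduct_comm (r • x l), dotProduct_smul, hzx l j hj]
        simp
      have h2 : κ⁻¹ * κ⁻¹ = 2 := by
        rw [← mul_inv, ← sq, hκ]; norm_num
      rw [smul_dotProduct, dotProduct_smul, h1, smul_eq_mul, smul_eq_mul, ← mul_assoc, h2,
        mul_add, hG i hi j hj]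
      field_simp
      ring)
  refine ⟨c - r • x l, M, hM, fun i hi => ?_⟩
  have h1 : Pi.single i κ = κ • (Pi.single i 1 : Fin n → ℂ) := by
    rw [← Pi.single_smul, smul_eq_mul, mul_one]
  rw [h1, mulVec_smul, hMo i hi, smul_smul, mul_inv_cancel₀ hκ0, one_smul]
  simp [z]

/-! ### Complex circles around a simplex and their images. -/

/-- The circle of points at equal `phi`-distance from the points `Pi.single i κ`, `i ≠ j₀`,
parametrized by `ℂ \ {0}`; here `μ ^ 2 = n - 1`. -/
noncomputable def circlePoint {n : ℕ} (j₀ : Fin n) (κ μ ρ ζ : ℂ) : Fin n → ℂ := fun i =>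
  if i = j₀ then ρ * (ζ - ζ⁻¹) / (2 * Complex.I)
  else κ / μ ^ 2 + ρ * (ζ + ζ⁻¹) / (2 * μ)

theorem sum_ite_eq_add {n : ℕ} (j₀ : Fin n) (p q : ℂ) :
    ∑ i, (if i = j₀ then p else q) = p + (n - 1) * q := by
  have h : ∀ i, (if i = j₀ then p else q) = (if i = j₀ then p - q else 0) + q := by
    intro i; split_ifs <;> ring
  rw [Finset.sum_congr rfl fun i _ => h i, Finset.sum_add_distrib]
  simp
  ring

theorem phi_circlePoint_circlePoint {n : ℕ} {j₀ : Fin n} {κ μ ρ : ℂ} (hμ : μ ^ 2 = n - 1)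
    (hμ0 : μ ≠ 0) {ζ ξ : ℂ} (hζ : ζ ≠ 0) (hξ : ξ ≠ 0) :
    phi (circlePoint j₀ κ μ ρ ζ) (circlePoint j₀ κ μ ρ ξ) = ρ ^ 2 * (2 - ζ / ξ - ξ / ζ) := by
  have h : ∀ i, (circlePoint j₀ κ μ ρ ζ i - circlePoint j₀ κ μ ρ ξ i) ^ 2 =
      if i = j₀ then (ρ * (ζ - ζ⁻¹) / (2 * Complex.I) - ρ * (ξ - ξ⁻¹) / (2 * Complex.I)) ^ 2
      else (ρ * (ζ + ζ⁻¹) / (2 * μ) - ρ * (ξ + ξ⁻¹) / (2 * μ)) ^ 2 := by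
    intro i
    unfold circlePoint
    split_ifs <;> ring
  rw [phi, Finset.sum_congr rfl fun i _ => h i, sum_ite_eq_add, ← hμ]
  field_simp
  rw [Complex.I_sq]
  ring

theorem phi_circlePoint_single {n : ℕ} {j₀ i : Fin n} (hi : i ≠ j₀) {κ μ ρ : ℂ}
    (hμ : μ ^ 2 = n - 1) (hμ0 : μ ≠ 0) {ζ : ℂ} (hζ : ζ ≠ 0) :
    phi (circlePoint j₀ κ μ ρ ζ) (Pi.single i κ) = ρ ^ 2 + κ ^ 2 - κ ^ 2 / μ ^ 2 := by
  have h : circlePoint j₀ κ μ ρ ζ ⬝ᵥ circlePoint j₀ κ μ ρ ζ = ∑ i,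
      if i = j₀ then (ρ * (ζ - ζ⁻¹) / (2 * Complex.I)) ^ 2
      else (κ / μ ^ 2 + ρ * (ζ + ζ⁻¹) / (2 * μ)) ^ 2 := by
    refine Finset.sum_congr rfl fun i _ => ?_
    unfold circlePoint
    split_ifs <;> ring
  rw [phi_expand, h, sum_ite_eq_add, ← hμ, dotProduct_single, dotProduct_single,
    Pi.single_eq_same, circlePoint, if_neg hi]
  field_simp
  rw [Complex.I_sq]
  ring

/-- Equal values of `phi` make the coordinates other than `j₀` coincide. In the remaining two
coordinates the equation is `u ^ 2 + X j₀ ^ 2 = ρ ^ 2`; its factors `u ± I * X j₀` are `ρ * ζ` and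
`ρ * ζ⁻¹`. -/
theorem eq_circlePoint {n : ℕ} {j₀ i₀ : Fin n} (hi₀ : i₀ ≠ j₀) {κ μ ρ : ℂ}
    (hμ : μ ^ 2 = n - 1) (hμ0 : μ ≠ 0) (hκ : κ ≠ 0) (hρ : ρ ≠ 0) {X : Fin n → ℂ}
    (hX : ∀ i, i ≠ j₀ → phi X (Pi.single i κ) = ρ ^ 2 + κ ^ 2 - κ ^ 2 / μ ^ 2) :
    (μ * (X i₀ - κ / μ ^ 2) + Complex.I * X j₀) / ρ ≠ 0 ∧
    X = circlePoint j₀ κ μ ρ ((μ * (X i₀ - κ / μ ^ 2) + Complex.I * X j₀) / ρ) := by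
  have hI := Complex.I_ne_zero
  have hXi : ∀ i, i ≠ j₀ → X i = X i₀ := by
    intro i hi
    have h1 := hX i hi
    have h2 := hX i₀ hi₀
    rw [phi_expand, dotProduct_single, dotProduct_single, Pi.single_eq_same] at h1 h2
    have h3 : κ * (X i - X i₀) = 0 := by linear_combination (h2 - h1) / 2
    exact sub_eq_zero.1 ((mul_eq_zero.1 h3).resolve_left hκ)
  have hXX : X ⬝ᵥ X = X j₀ ^ 2 + μ ^ 2 * X i₀ ^ 2 := by
    rw [hμ, ← sum_ite_eq_add j₀]
    refine Finset.sum_congr rfl fun i _ => ?_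
    split_ifs with h
    · rw [h]; ring
    · rw [hXi i h]; ring
  have h1 := hX i₀ hi₀
  rw [phi_expand, dotProduct_single, dotProduct_single, Pi.single_eq_same, hXX] at h1
  obtain ⟨u, hu⟩ : ∃ u, u = μ * (X i₀ - κ / μ ^ 2) := ⟨_, rfl⟩
  have hXu : X i₀ = κ / μ ^ 2 + u / μ := by rw [hu]; field_simp; ring
  rw [← hu]
  have h2 : (u + Complex.I * X j₀) * (u - Complex.I * X j₀) = ρ ^ 2 := by
    rw [hXu] at h1
    field_simp at h1
    have h3 : μ ^ 2 * (u ^ 2 + X j₀ ^ 2 - ρ ^ 2) = 0 := by linear_combination h1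
    have h4 := (mul_eq_zero.1 h3).resolve_left (pow_ne_zero 2 hμ0)
    linear_combination h4 - X j₀ ^ 2 * Complex.I_sq
  have hne : u + Complex.I * X j₀ ≠ 0 := by
    intro h
    rw [h, zero_mul] at h2
    exact pow_ne_zero 2 hρ h2.symm
  have hinv : ((u + Complex.I * X j₀) / ρ)⁻¹ = (u - Complex.I * X j₀) / ρ := by
    rw [inv_div, div_eq_div_iff hne hρ]
    linear_combination -h2
  refine ⟨div_ne_zero hne hρ, ?_⟩
  ext i
  rw [circlePoint, hinv]
  split_ifs with h
  · rw [h]; field_simp; ring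
  · rw [hXi i h, hXu]; field_simp; ring

/-- The circle is mapped to a congruent circle by a continuous change of parameter. -/
theorem exists_circle_map {n : ℕ} {j₀ i₀ : Fin n} (hi₀ : i₀ ≠ j₀) {κ μ ρ a : ℂ}
    (hμ : μ ^ 2 = n - 1) (hμ0 : μ ≠ 0) (hκ : κ ^ 2 = 1 / 2) (hρ0 : ρ ≠ 0)
    (hρ : a = ρ ^ 2 + κ ^ 2 - κ ^ 2 / μ ^ 2)
    {f : (Fin n → ℂ) → (Fin n → ℂ)} (hf : Continuous f)
    (h1 : PreservesPhi f 1) (ha : PreservesPhi f a) :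
    ∃ g : ℂ → ℂ, ContinuousOn g {0}ᶜ ∧ (∀ ζ, ζ ≠ 0 → g ζ ≠ 0) ∧
      ∀ ζ ξ, ζ ≠ 0 → ξ ≠ 0 →
        phi (f (circlePoint j₀ κ μ ρ ζ)) (f (circlePoint j₀ κ μ ρ ξ)) =
          ρ ^ 2 * (2 - g ζ / g ξ - g ξ / g ζ) := by
  have hκ0 : κ ≠ 0 := by rintro rfl; norm_num at hκ
  obtain ⟨p, M, hM, hp⟩ := exists_rigid_of_regular_simplex (s := Finset.univ.erase j₀)
    ⟨i₀, by simp [hi₀]⟩ hκ (fun i => f (Pi.single i κ)) (by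
      intro i _ j _ hij
      refine h1 _ _ ?_
      rw [phi_expand]
      simp only [dotProduct_single, Pi.single_eq_same, Pi.single_eq_of_ne hij.symm]
      linear_combination 2 * hκ)
  have hM' : M * Mᵀ = 1 := mul_eq_one_comm.1 hM
  let F : ℂ → Fin n → ℂ := fun ζ => Mᵀ *ᵥ (f (circlePoint j₀ κ μ ρ ζ) - p)
  have hF : ∀ ζ, f (circlePoint j₀ κ μ ρ ζ) = p + M *ᵥ F ζ := by
    intro ζ
    simp [F, mulVec_mulVec, hM']
  let g : ℂ → ℂ := fun ζ => (μ * (F ζ i₀ - κ / μ ^ 2) + Complex.I * F ζ j₀) / ρ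
  have hg : ∀ ζ, ζ ≠ 0 → g ζ ≠ 0 ∧ F ζ = circlePoint j₀ κ μ ρ (g ζ) := by
    intro ζ hζ
    refine eq_circlePoint hi₀ hμ hμ0 hκ0 hρ0 fun i hi => ?_
    have h2 := ha _ _ ((phi_circlePoint_single hi hμ hμ0 hζ).trans hρ.symm)
    rwa [hF, hp i (by simp [hi]), phi_rigid hM, hρ] at h2
  have hFc : ContinuousOn F {0}ᶜ := by
    have hc : ContinuousOn (circlePoint j₀ κ μ ρ) {0}ᶜ := by
      refine continuousOn_pi.2 fun i => ?_
      have hi : ContinuousOn (fun ζ : ℂ => ζ⁻¹) {0}ᶜ := continuousOn_inv₀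
      unfold circlePoint
      split_ifs
      · fun_prop
      · fun_prop
    have h3 : Continuous fun Y => Mᵀ *ᵥ (f Y - p) :=
      Continuous.matrix_mulVec continuous_const (hf.sub continuous_const)
    exact h3.comp_continuousOn hc
  refine ⟨g, ?_, fun ζ hζ => (hg ζ hζ).1, fun ζ ξ hζ hξ => ?_⟩
  · have h4 := continuousOn_pi.1 hFc
    have h5 := h4 i₀
    have h6 := h4 j₀
    fun_prop
  · rw [hF, hF, phi_rigid hM, (hg ζ hζ).2, (hg ξ hξ).2,
      phi_circlePoint_circlePoint hμ hμ0 (hg ζ hζ).1 (hg ξ hξ).1]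

/-- A continuous self-map of `ℂ \ {0}` compatible with the chord of a rotation is equivariant
under that rotation, up to inverting it. -/
theorem exists_rotation_equivariant {g : ℂ → ℂ} (hg : ContinuousOn g {0}ᶜ)
    (hg0 : ∀ ζ, ζ ≠ 0 → g ζ ≠ 0) {ω : ℂ} (hω : ω ≠ 0)
    (h : ∀ ζ, ζ ≠ 0 → g (ω * ζ) / g ζ + g ζ / g (ω * ζ) = ω + ω⁻¹) :
    ∃ η : ℂ, (η = ω ∨ η = ω⁻¹) ∧ ∀ ζ, ζ ≠ 0 → g (ω * ζ) = η * g ζ := by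
  have hq : ∀ ζ, ζ ≠ 0 → g (ω * ζ) / g ζ = ω ∨ g (ω * ζ) / g ζ = ω⁻¹ := by
    intro ζ hζ
    have h1 := h ζ hζ
    have h2 := hg0 ζ hζ
    have h3 := hg0 _ (mul_ne_zero hω hζ)
    obtain ⟨q, hq⟩ : ∃ q, q = g (ω * ζ) / g ζ := ⟨_, rfl⟩
    have hq0 : q ≠ 0 := by rw [hq]; exact div_ne_zero h3 h2
    have h4 : g ζ / g (ω * ζ) = q⁻¹ := by rw [hq, inv_div]
    rw [h4, ← hq] at h1
    rw [← hq]
    have h5 : (q - ω) * (q - ω⁻¹) = 0 := by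
      field_simp at h1 ⊢
      linear_combination h1
    rcases mul_eq_zero.1 h5 with h6 | h6
    · exact Or.inl (sub_eq_zero.1 h6)
    · exact Or.inr (sub_eq_zero.1 h6)
  have hconn : IsPreconnected ({0}ᶜ : Set ℂ) :=
    (isConnected_compl_singleton_of_one_lt_rank (by simp) 0).isPreconnected
  have hmaps : Set.MapsTo (fun ζ => ω * ζ) ({0}ᶜ : Set ℂ) {0}ᶜ := fun ζ hζ => mul_ne_zero hω hζ
  have hc : ContinuousOn (fun ζ => g (ω * ζ) / g ζ) {0}ᶜ :=
    (hg.comp (continuous_const.mul continuous_id).continuousOn hmaps).div hg hg0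
  -- The quotient is continuous on a connected set and takes at most two values, hence is constant.
  have hsub := (Set.toFinite {ω, ω⁻¹}).countable.isTotallyDisconnected _
    (by rintro _ ⟨ζ, hζ, rfl⟩; exact hq ζ hζ) (hconn.image _ hc)
  refine ⟨g (ω * 1) / g 1, hq 1 one_ne_zero, fun ζ hζ => ?_⟩
  rw [← (hsub ⟨ζ, hζ, rfl⟩ ⟨1, one_ne_zero, rfl⟩ : g (ω * ζ) / g ζ = g (ω * 1) / g 1)]
  exact (div_mul_cancel₀ _ (hg0 ζ hζ)).symm

/-- Multiples of a preserved chord of length `1` on the circle are preserved. -/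
theorem phi_chord_zpow {n : ℕ} {j₀ i₀ : Fin n} (hi₀ : i₀ ≠ j₀) {κ μ ρ a : ℂ}
    (hμ : μ ^ 2 = n - 1) (hμ0 : μ ≠ 0) (hκ : κ ^ 2 = 1 / 2) (hρ0 : ρ ≠ 0)
    (hρ : a = ρ ^ 2 + κ ^ 2 - κ ^ 2 / μ ^ 2)
    {f : (Fin n → ℂ) → (Fin n → ℂ)} (hf : Continuous f)
    (h1 : PreservesPhi f 1) (ha : PreservesPhi f a) {ω : ℂ} (hω : ω ≠ 0)
    (hω1 : ρ ^ 2 * (2 - ω - ω⁻¹) = 1) (k : ℤ) :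
    phi (f (circlePoint j₀ κ μ ρ (ω ^ k))) (f (circlePoint j₀ κ μ ρ 1)) =
      ρ ^ 2 * (2 - ω ^ k - (ω ^ k)⁻¹) := by
  obtain ⟨g, hg, hg0, hgf⟩ := exists_circle_map hi₀ hμ hμ0 hκ hρ0 hρ hf h1 ha
  obtain ⟨η, hη, hgη⟩ := exists_rotation_equivariant hg hg0 hω (by
    intro ζ hζ
    have h2 := hgf _ _ (mul_ne_zero hω hζ) hζ
    rw [h1 _ _ (by
      rw [phi_circlePoint_circlePoint hμ hμ0 (mul_ne_zero hω hζ) hζ, ← hω1]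
      field_simp)] at h2
    rw [← hω1] at h2
    have h3 := mul_left_cancel₀ (pow_ne_zero 2 hρ0) h2
    linear_combination h3)
  have hη0 : η ≠ 0 := by rcases hη with rfl | rfl <;> simp [hω]
  have hpow : ∀ k : ℤ, g (ω ^ k) = η ^ k * g 1 := by
    intro k
    induction k using Int.induction_on with
    | zero => simp
    | succ k ih =>
      rw [add_comm, zpow_one_add₀ hω, hgη _ (zpow_ne_zero _ hω), ih, zpow_one_add₀ hη0, mul_assoc]
    | pred k ih =>
      have h2 := hgη _ (zpow_ne_zero (-(k : ℤ) - 1) hω)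
      rw [← zpow_one_add₀ hω, show 1 + (-(k : ℤ) - 1) = -k by ring, ih] at h2
      rw [zpow_sub_one₀ hη0]
      field_simp
      linear_combination -h2
  have hg1 := hg0 1 one_ne_zero
  rw [hgf _ _ (zpow_ne_zero k hω) one_ne_zero, hpow]
  have h3 : η ^ k * g 1 / g 1 = η ^ k := by field_simp
  have h4 : g 1 / (η ^ k * g 1) = (η ^ k)⁻¹ := by field_simp
  rw [h3, h4]
  -- The chord is unchanged when the rotation is inverted, so both orientations give the same value.
  rcases hη with rfl | rfl
  · rfl
  · rw [_root_.inv_zpow, inv_inv]; ring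

/-! ### From the value `1` to all positive real values. -/

theorem exp_mul_I_add_inv (t : ℝ) :
    Complex.exp (t * Complex.I) + (Complex.exp (t * Complex.I))⁻¹ = (2 * Real.cos t : ℝ) := by
  rw [← Complex.exp_neg]
  push_cast
  rw [Complex.cos]
  ring_nf

/-- If `f` preserves `1` and `a`, and `θ` is the angle of a unit chord of a circle of squared
radius `R = a - 1 / 2 + 1 / (2 * (n - 1))`, then the chords of all angles `t` in the closure of
the group generated by `θ` and `2 * π` are preserved. -/
theorem preservesPhi_of_mem_closure {n : ℕ} (hn : 2 ≤ n) {a R : ℝ} (hR0 : 0 < R)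
    (hR : R = a - 1 / 2 + 1 / (2 * (n - 1)))
    {f : (Fin n → ℂ) → (Fin n → ℂ)} (hf : Continuous f)
    (h1 : PreservesPhi f 1) (ha : PreservesPhi f a) {θ : ℝ} (hθ : 2 * R * (1 - Real.cos θ) = 1)
    {t : ℝ} (ht : t ∈ closure (AddSubgroup.closure {θ, 2 * Real.pi} : Set ℝ))
    (ht0 : 2 * R * (1 - Real.cos t) ≠ 0) :
    PreservesPhi f (2 * R * (1 - Real.cos t) : ℝ) := by
  obtain ⟨κ, hκ⟩ := IsAlgClosed.exists_pow_nat_eq (1 / 2 : ℂ) (n := 2) two_pos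
  obtain ⟨μ, hμ⟩ := IsAlgClosed.exists_pow_nat_eq ((n : ℂ) - 1) (n := 2) two_pos
  obtain ⟨ρ, hρ⟩ := IsAlgClosed.exists_pow_nat_eq (R : ℂ) (n := 2) two_pos
  have hn1 : (n : ℂ) - 1 ≠ 0 := by
    intro h
    have : (n : ℂ) = (1 : ℕ) := by push_cast; linear_combination h
    have : n = 1 := by exact_mod_cast this
    omega
  have hμ0 : μ ≠ 0 := by rintro rfl; exact hn1 (by rw [← hμ]; ring)
  have hρ0 : ρ ≠ 0 := by
    rintro rfl
    have : (R : ℂ) = 0 := by rw [← hρ]; ring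
    exact hR0.ne' (by exact_mod_cast this)
  have hρ' : (a : ℂ) = ρ ^ 2 + κ ^ 2 - κ ^ 2 / μ ^ 2 := by
    rw [hρ, hκ, hμ, hR]
    push_cast
    field_simp
    ring
  let j₀ : Fin n := ⟨0, by omega⟩
  let i₀ : Fin n := ⟨1, by omega⟩
  have hij : i₀ ≠ j₀ := by simp [i₀, j₀, Fin.ext_iff]
  let E : ℝ → ℂ := fun t => Complex.exp (t * Complex.I)
  have hE0 : ∀ t, E t ≠ 0 := fun t => Complex.exp_ne_zero _
  have hE : ∀ t, ρ ^ 2 * (2 - E t - (E t)⁻¹) = (2 * R * (1 - Real.cos t) : ℝ) := by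
    intro t
    have h2 := exp_mul_I_add_inv t
    rw [hρ]
    push_cast at h2 ⊢
    linear_combination -(R : ℂ) * h2
  have key : ∀ F : (Fin n → ℂ) → (Fin n → ℂ), Continuous F → PreservesPhi F 1 →
      PreservesPhi F a → phi (F (circlePoint j₀ κ μ ρ (E t))) (F (circlePoint j₀ κ μ ρ 1)) =
        (2 * R * (1 - Real.cos t) : ℝ) := by
    intro F hF hF1 hFa
    let S : Set ℝ := {t | phi (F (circlePoint j₀ κ μ ρ (E t))) (F (circlePoint j₀ κ μ ρ 1)) =
        (2 * R * (1 - Real.cos t) : ℝ)}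
    have hEc : Continuous E := by fun_prop
    have hcirc : Continuous fun t => circlePoint j₀ κ μ ρ (E t) := by
      refine continuous_pi fun i => ?_
      have hi : Continuous fun t => (E t)⁻¹ := hEc.inv₀ hE0
      unfold circlePoint
      split_ifs
      · fun_prop
      · fun_prop
    have hS : IsClosed S := by
      refine isClosed_eq ?_ ?_
      · have h2 : Continuous fun t => F (circlePoint j₀ κ μ ρ (E t)) := hF.comp hcirc
        unfold phi
        fun_prop
      · exact Complex.continuous_ofReal.comp
          (continuous_const.mul (continuous_const.sub Real.continuous_cos))
    have hsub : (AddSubgroup.closure {θ, 2 * Real.pi} : Set ℝ) ⊆ S := by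
      intro u hu
      obtain ⟨k, l, rfl⟩ := AddSubgroup.mem_closure_pair.1 hu
      have hEu : E (k • θ + l • (2 * Real.pi)) = E θ ^ k := by
        simp only [E]
        rw [← Complex.exp_int_mul,
          ← (Complex.exp_periodic.int_mul l) ((k : ℂ) * (θ * Complex.I))]
        congr 1
        simp
        ring
      have h2 := phi_chord_zpow hij hμ hμ0 hκ hρ0 hρ' hF hF1 hFa (hE0 θ)
        (by rw [hE, hθ]; simp) k
      rw [← hEu, hE] at h2
      exact h2
    exact closure_minimal hsub hS ht
  -- Since the value is nonzero, a rigid motion carries the model chord to `X`, `Y`; `key` is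
  -- applied to `f` composed with that motion.
  intro X Y hXY
  have hc : phi (circlePoint j₀ κ μ ρ (E t)) (circlePoint j₀ κ μ ρ 1) =
      (2 * R * (1 - Real.cos t) : ℝ) := by
    rw [phi_circlePoint_circlePoint hμ hμ0 (hE0 t) one_ne_zero, ← hE, div_one, one_div]
  obtain ⟨M, hM, hMv⟩ := exists_orthogonal_mulVec_eq
    (v := circlePoint j₀ κ μ ρ (E t) - circlePoint j₀ κ μ ρ 1) (w := X - Y)
    (by rw [← phi_eq_dotProduct, hc]; exact_mod_cast ht0)
    (by rw [← phi_eq_dotProduct, ← phi_eq_dotProduct, hc, hXY])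
  have h2 := key (fun Z => f ((Y - M *ᵥ circlePoint j₀ κ μ ρ 1) + M *ᵥ Z))
    (hf.comp (continuous_const.add (Continuous.matrix_mulVec continuous_const continuous_id)))
    (h1.comp_rigid hM _) (ha.comp_rigid hM _)
  rw [mulVec_sub] at hMv
  have h3 : Y - M *ᵥ circlePoint j₀ κ μ ρ 1 + M *ᵥ circlePoint j₀ κ μ ρ (E t) = X := by
    rw [sub_add_eq_add_sub, add_sub_assoc, hMv, add_sub_cancel]
  simp only [h3, sub_add_cancel] at h2
  exact h2

/-- By Niven's theorem, if the angle `θ` of a unit chord has a rational cosine other than the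
exceptional ones, then all small positive values are preserved. -/
theorem preservesPhi_of_cos_rat {n : ℕ} (hn : 2 ≤ n) {a R : ℝ} (hR0 : 1 / 2 ≤ R)
    (hR : R = a - 1 / 2 + 1 / (2 * (n - 1)))
    {f : (Fin n → ℂ) → (Fin n → ℂ)} (hf : Continuous f)
    (h1 : PreservesPhi f 1) (ha : PreservesPhi f a) (q : ℚ) (hq : 2 * R * (1 - q) = 1)
    (hq0 : 0 < q) (hq1 : q < 1) (hq2 : q ≠ 1 / 2) {s : ℝ} (hs0 : 0 < s) (hs : s ≤ 2) :
    PreservesPhi f s := by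
  have hq0' : (0 : ℝ) < q := by exact_mod_cast hq0
  have hq1' : (q : ℝ) < 1 := by exact_mod_cast hq1
  have hcos : Real.cos (Real.arccos q) = q := Real.cos_arccos (by linarith) hq1'.le
  have hirr : Irrational (Real.arccos q / (2 * Real.pi)) := by
    rintro ⟨r, hr⟩
    have h2 := niven (θ := Real.arccos q) ⟨2 * r, by
      have := Real.pi_pos
      push_cast
      rw [hr]
      field_simp⟩ ⟨q, hcos⟩
    rw [hcos] at h2
    have hq2' : (q : ℝ) ≠ 1 / 2 := by
      intro h
      apply hq2
      have : (q : ℝ) = ((1 / 2 : ℚ) : ℝ) := by rw [h]; norm_num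
      exact_mod_cast this
    simp only [Set.mem_insert_iff, Set.mem_singleton_iff] at h2
    rcases h2 with h | h | h | h | h
    · linarith
    · linarith
    · linarith
    · exact hq2' h
    · linarith
  have hdense := dense_addSubgroupClosure_pair_iff.2 hirr
  have hR1 : 0 < R := by linarith
  -- The bounds `1 / 2 ≤ R` and `s ≤ 2` keep `1 - s / (2 * R)` in the domain where `arccos` inverts
  -- `cos`.
  have hcos2 : Real.cos (Real.arccos (1 - s / (2 * R))) = 1 - s / (2 * R) := by
    refine Real.cos_arccos ?_ ?_
    · have : s / (2 * R) ≤ 2 := by rw [div_le_iff₀ (by linarith)]; linarith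
      linarith
    · have : 0 < s / (2 * R) := by positivity
      linarith
  have hval : 2 * R * (1 - Real.cos (Real.arccos (1 - s / (2 * R)))) = s := by
    rw [hcos2]; field_simp; ring
  have h3 := preservesPhi_of_mem_closure hn hR1 hR hf h1 ha (θ := Real.arccos q)
    (by rw [hcos]; exact hq) (hdense (Real.arccos (1 - s / (2 * R))))
    (by rw [hval]; exact hs0.ne')
  rwa [hval] at h3

/-- For `n ≥ 3` the choice `a = 1` gives a unit chord with cosine `1 / n`, which Niven's theorem
admits. For `n = 2` it gives the exceptional cosine `1 / 2`; doubling the angle `π / 3` on the unit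
circle shows that `3` is preserved, and the circle with `R = 3` has cosine `5 / 6`. -/
theorem preservesPhi_of_le_two {n : ℕ} (hn : 2 ≤ n)
    {f : (Fin n → ℂ) → (Fin n → ℂ)} (hf : Continuous f) (h1 : PreservesPhi f 1)
    {s : ℝ} (hs0 : 0 < s) (hs : s ≤ 2) : PreservesPhi f s := by
  rcases hn.eq_or_lt with rfl | hn3
  · have h3 : PreservesPhi f (3 : ℝ) := by
      have hc : Real.cos (2 * (Real.pi / 3)) = -1 / 2 := by
        rw [Real.cos_two_mul, Real.cos_pi_div_three]; norm_num
      have h2 := preservesPhi_of_mem_closure le_rfl (a := 1) (R := 1) one_pos (by norm_num) hf h1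
        (by simpa using h1) (θ := Real.pi / 3) (by rw [Real.cos_pi_div_three]; norm_num)
        (t := 2 * (Real.pi / 3)) (subset_closure (by
          have := (AddSubgroup.closure {Real.pi / 3, 2 * Real.pi}).nsmul_mem
            (AddSubgroup.subset_closure (Set.mem_insert _ _)) 2
          simpa using this))
        (by rw [hc]; norm_num)
      rw [hc] at h2
      norm_num at h2 ⊢
      exact h2
    exact preservesPhi_of_cos_rat le_rfl (a := 3) (R := 3) (by norm_num) (by norm_num) hf h1
      h3 (5 / 6) (by norm_num) (by norm_num) (by norm_num) (by norm_num) hs0 hs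
  · have hnR : (3 : ℝ) ≤ n := by exact_mod_cast hn3
    have hnQ : (3 : ℚ) ≤ n := by exact_mod_cast hn3
    have hn0 : (0 : ℝ) < n - 1 := by linarith
    refine preservesPhi_of_cos_rat hn (a := 1) (R := n / (2 * (n - 1))) ?_ ?_ hf h1
      (by simpa using h1) (1 / n) ?_ ?_ ?_ ?_ hs0 hs
    · rw [le_div_iff₀ (by linarith)]; linarith
    · field_simp; ring
    · push_cast; field_simp
    · positivity
    · rw [div_lt_one (by linarith)]; linarith
    · intro h
      field_simp at h
      linarith

/-- A continuous map preserving `1` preserves all positive real values. -/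
theorem preservesPhi_of_pos {n : ℕ} (hn : 2 ≤ n)
    {f : (Fin n → ℂ) → (Fin n → ℂ)} (hf : Continuous f) (h1 : PreservesPhi f 1)
    {s : ℝ} (hs0 : 0 < s) : PreservesPhi f s := by
  have key : ∀ k : ℕ, ∀ s : ℝ, 0 < s → s ≤ 2 ^ k → PreservesPhi f s := by
    intro k
    induction k with
    | zero => exact fun s h h' => preservesPhi_of_le_two hn hf h1 h (by norm_num at h'; linarith)
    | succ k ih =>
      intro s h h'
      have hr : 0 < Real.sqrt (2 ^ k) := Real.sqrt_pos.2 (by positivity)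
      have hrsq : Real.sqrt (2 ^ k) ^ 2 = 2 ^ k := Real.sq_sqrt (by positivity)
      obtain ⟨c, hc⟩ : ∃ c : ℂ, c = (Real.sqrt (2 ^ k) : ℝ) := ⟨_, rfl⟩
      have hc0 : c ≠ 0 := by rw [hc]; exact_mod_cast hr.ne'
      have hcsq : c ^ 2 = ((2 ^ k : ℝ) : ℂ) := by rw [hc, ← Complex.ofReal_pow, hrsq]
      -- Once `2 ^ k` is preserved it can serve as the unit, which extends the range to `2 * 2 ^ k`.
      have h2 := preservesPhi_of_le_two hn (f := fun X => c⁻¹ • f (c • X)) (by fun_prop)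
        (PreservesPhi.rescale hc0 (by
          rw [hcsq, mul_one]; exact ih _ (by positivity) le_rfl))
        (s := s / 2 ^ k) (by positivity) (by
          rw [div_le_iff₀ (by positivity)]; rw [pow_succ] at h'; linarith)
      have h3 := h2.of_rescale hc0
      rw [hcsq, ← Complex.ofReal_mul, mul_div_cancel₀ _ (by positivity)] at h3
      exact h3
  obtain ⟨k, hk⟩ := pow_unbounded_of_one_lt s (one_lt_two : (1 : ℝ) < 2)
  exact key k s hs0 hk.le

/-! ### Affinity on real forms, lines and planes. -/

/-- The real vector `x` seen in `ℂⁿ`. -/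
def realVec {n : ℕ} (x : Fin n → ℝ) : Fin n → ℂ := fun i => (x i : ℂ)

theorem realVec_single {n : ℕ} (j : Fin n) (t : ℝ) :
    realVec (Pi.single j t) = Pi.single j (t : ℂ) := by
  ext i
  by_cases h : i = j
  · subst h; simp [realVec]
  · simp [realVec, h]

theorem realVec_add {n : ℕ} (x y : Fin n → ℝ) : realVec (x + y) = realVec x + realVec y := by
  ext i; simp [realVec]

theorem realVec_sub {n : ℕ} (x y : Fin n → ℝ) : realVec (x - y) = realVec x - realVec y := by
  ext i; simp [realVec]

section RealForm

variable {n : ℕ} {f : (Fin n → ℂ) → (Fin n → ℂ)}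

theorem phi_realVec_of_preservesPhi (hn : 2 ≤ n) (hf : Continuous f) (h1 : PreservesPhi f 1)
    (x y : Fin n → ℝ) : phi (f (realVec x)) (f (realVec y)) = phi (realVec x) (realVec y) := by
  have h2 : phi (realVec x) (realVec y) = (∑ i, (x i - y i) ^ 2 : ℝ) := by
    simp [phi, realVec]
  rcases (Finset.sum_nonneg fun i _ => sq_nonneg (x i - y i) :
    0 ≤ ∑ i, (x i - y i) ^ 2).eq_or_lt with h | h
  · have h3 : x = y := by
      ext i
      have := (Finset.sum_eq_zero_iff_of_nonneg fun i _ => sq_nonneg (x i - y i)).1 h.symm i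
        (Finset.mem_univ i)
      exact sub_eq_zero.1 (pow_eq_zero_iff two_ne_zero |>.1 this)
    subst h3
    simp [phi]
  · rw [h2]
    exact preservesPhi_of_pos hn hf h1 h _ _ h2

/-- A continuous map preserving `1` is an isometric real-affine map on the standard real form. -/
theorem exists_orthogonal_eq_on_real (hn : 2 ≤ n) (hf : Continuous f) (h1 : PreservesPhi f 1) :
    ∃ G : Matrix (Fin n) (Fin n) ℂ, Gᵀ * G = 1 ∧
      ∀ x : Fin n → ℝ, f (realVec x) = f 0 + G *ᵥ realVec x := by
  have h0 : realVec (0 : Fin n → ℝ) = 0 := by ext i; simp [realVec]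
  have key : ∀ x y : Fin n → ℝ, (f (realVec x) - f 0) ⬝ᵥ (f (realVec y) - f 0) =
      realVec x ⬝ᵥ realVec y := by
    intro x y
    have e1 := phi_realVec_of_preservesPhi hn hf h1 x y
    have e2 := phi_realVec_of_preservesPhi hn hf h1 x 0
    have e3 := phi_realVec_of_preservesPhi hn hf h1 y 0
    rw [phi_expand, phi_expand] at e1 e2 e3
    rw [h0] at e2 e3
    simp only [dotProduct_zero, mul_zero] at e2 e3
    rw [sub_dotProduct, dotProduct_sub, dotProduct_sub, dotProduct_comm (f 0) (f (realVec y))]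
    linear_combination (e2 + e3 - e1) / 2
  have hs : ∀ i : Fin n, realVec (Pi.single i 1) = Pi.single i 1 := fun i => by
    rw [realVec_single, Complex.ofReal_one]
  obtain ⟨G, hG, hGo⟩ := exists_orthogonal_of_orthonormalOn Finset.univ
    (fun i => f (realVec (Pi.single i 1)) - f 0) (by
      intro i _ j _
      rw [key, hs, hs, dotProduct_single, Pi.single_apply, mul_one]
      simp only [eq_comm])
  refine ⟨G, hG, fun x => ?_⟩
  -- The coordinates of `f (realVec x) - f 0` in the orthonormal columns of `G` are products known
  -- from `key`.
  have h3 : Gᵀ *ᵥ (f (realVec x) - f 0) = realVec x := by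
    ext i
    rw [← single_one_dotProduct i (Gᵀ *ᵥ _), dotProduct_mulVec, vecMul_transpose,
      hGo i (Finset.mem_univ i), key, hs, single_one_dotProduct]
  have h4 := congrArg (fun Z => G *ᵥ Z) h3
  simp only [mulVec_mulVec, mul_eq_one_comm.1 hG, one_mulVec] at h4
  rw [← h4, add_sub_cancel]

/-- A line whose direction has positive square is a rigid image of a real coordinate axis. -/
theorem exists_line_map (hn : 2 ≤ n) (hf : Continuous f) (h1 : PreservesPhi f 1)
    {v : Fin n → ℂ} {a : ℝ} (ha : 0 < a) (hv : v ⬝ᵥ v = a) (A : Fin n → ℂ) :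
    ∃ p : Fin n → ℂ, p ⬝ᵥ p = a ∧ ∀ t : ℝ, f (A + (t : ℂ) • v) = f A + (t : ℂ) • p := by
  let i : Fin n := ⟨0, by omega⟩
  have hr : (Real.sqrt a : ℂ) * Real.sqrt a = a := by
    rw [← Complex.ofReal_mul, Real.mul_self_sqrt ha.le]
  obtain ⟨M, hM, hMv⟩ := exists_orthogonal_mulVec_eq (v := Pi.single i (Real.sqrt a : ℂ)) (w := v)
    (by rw [dotProduct_single, Pi.single_eq_same, hr]; exact_mod_cast ha.ne')
    (by rw [dotProduct_single, Pi.single_eq_same, hr, hv])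
  obtain ⟨G, hG, hGf⟩ := exists_orthogonal_eq_on_real hn (f := fun X => f (A + M *ᵥ X))
    (hf.comp (continuous_const.add (Continuous.matrix_mulVec continuous_const continuous_id)))
    (h1.comp_rigid hM A)
  refine ⟨G *ᵥ Pi.single i (Real.sqrt a : ℂ), ?_, fun t => ?_⟩
  · rw [mulVec_dotProduct_mulVec_of_orthogonal hG, dotProduct_single, Pi.single_eq_same, hr]
  · have h2 := hGf (Pi.single i (t * Real.sqrt a))
    have h3 : (Pi.single i ((t * Real.sqrt a : ℝ) : ℂ) : Fin n → ℂ) =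
        (t : ℂ) • Pi.single i (Real.sqrt a : ℂ) := by
      rw [← Pi.single_smul]; simp
    rw [realVec_single, h3, mulVec_smul, mulVec_smul, hMv, mulVec_zero, add_zero] at h2
    exact h2

/-- Affinity along `v` and `w` leaves only a term in `x * y`. On the diagonal `x = y` it would be
quadratic, against affinity along `v + w`. -/
theorem exists_plane_map (hn : 2 ≤ n) (hf : Continuous f) (h1 : PreservesPhi f 1)
    {v w : Fin n → ℂ} {a b c : ℝ} (ha : 0 < a) (hv : v ⬝ᵥ v = a) (hb : 0 < b) (hw : w ⬝ᵥ w = b)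
    (hc : 0 < c) (hvw : (v + w) ⬝ᵥ (v + w) = c) (A : Fin n → ℂ) :
    ∃ p q : Fin n → ℂ, p ⬝ᵥ p = v ⬝ᵥ v ∧ q ⬝ᵥ q = w ⬝ᵥ w ∧ p ⬝ᵥ q = v ⬝ᵥ w ∧
      ∀ x y : ℝ, f (A + (x : ℂ) • v + (y : ℂ) • w) = f A + (x : ℂ) • p + (y : ℂ) • q := by
  obtain ⟨p, hp, hpf⟩ := exists_line_map hn hf h1 ha hv A
  obtain ⟨p', -, hpf'⟩ := exists_line_map hn hf h1 ha hv (A + w)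
  obtain ⟨q, hq, hqf⟩ := exists_line_map hn hf h1 hb hw A
  obtain ⟨r, hr, hrf⟩ := exists_line_map hn hf h1 hc hvw A
  have hq1 := hqf 1
  simp only [Complex.ofReal_one, one_smul] at hq1
  have hform : ∀ x y : ℝ, f (A + (x : ℂ) • v + (y : ℂ) • w) =
      f A + (x : ℂ) • p + (y : ℂ) • (q + (x : ℂ) • (p' - p)) := by
    intro x y
    obtain ⟨u, -, hu⟩ := exists_line_map hn hf h1 hb hw (A + (x : ℂ) • v)
    have hu1 := hu 1
    simp only [Complex.ofReal_one, one_smul] at hu1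
    rw [add_right_comm, hpf' x, hq1, hpf x] at hu1
    have : u = q + (x : ℂ) • (p' - p) := by
      rw [smul_sub]
      linear_combination (exp := 1) -hu1
    rw [hu y, hpf x, this]
  have hr' : ∀ t : ℝ, (t : ℂ) • r = (t : ℂ) • p + (t : ℂ) • (q + (t : ℂ) • (p' - p)) := by
    intro t
    have e1 := hform t t
    rw [add_assoc, ← smul_add, hrf t, add_assoc] at e1
    exact add_left_cancel e1
  have e1 := hr' 1
  have e2 := hr' 2
  have hpp : p' = p := by
    ext i
    have i1 := congrFun e1 i
    have i2 := congrFun e2 i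
    simp at i1 i2
    linear_combination (i2 - 2 * i1) / (-2)
  have hrpq : r = p + q := by
    rw [hpp] at e1
    simpa using e1
  refine ⟨p, q, by rw [hp, hv], by rw [hq, hw], ?_, fun x y => by rw [hform, hpp]; simp⟩
  rw [← hvw, hrpq] at hr
  simp only [add_dotProduct, dotProduct_add, hp, hq, hv, hw, dotProduct_comm q p,
    dotProduct_comm w v] at hr
  linear_combination hr / 2

/-- The direction `w` has negative square, but the plane is also spanned by `2 • v + w` and `v`,
which together with their sum have squares `3 * a`, `a` and `8 * a`. -/
theorem exists_lorentz_plane_map (hn : 2 ≤ n) (hf : Continuous f) (h1 : PreservesPhi f 1)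
    {v w : Fin n → ℂ} {a : ℝ} (ha : 0 < a) (hv : v ⬝ᵥ v = a) (hw : w ⬝ᵥ w = -a)
    (hvw : v ⬝ᵥ w = 0) (A : Fin n → ℂ) :
    ∃ p q : Fin n → ℂ, q ⬝ᵥ q = -a ∧ p ⬝ᵥ q = 0 ∧
      ∀ x y : ℝ, f (A + (x : ℂ) • v + (y : ℂ) • w) = f A + (x : ℂ) • p + (y : ℂ) • q := by
  have hwv : w ⬝ᵥ v = 0 := by rw [dotProduct_comm, hvw]
  obtain ⟨P, Q, hP, hQ, hPQ, hf'⟩ := exists_plane_map hn hf h1 (v := (2 : ℂ) • v + w) (w := v)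
    (a := 3 * a) (b := a) (c := 8 * a) (by positivity)
    (by simp [hv, hw, hvw, hwv]; ring) ha hv (by positivity)
    (by simp [hv, hw, hvw, hwv]; ring) A
  simp only [dotProduct_add, add_dotProduct, smul_dotProduct, dotProduct_smul, hv, hw, hvw, hwv,
    smul_eq_mul] at hP hQ hPQ
  refine ⟨Q, P - (2 : ℂ) • Q, ?_, ?_, fun x y => ?_⟩
  · simp only [sub_dotProduct, dotProduct_sub, smul_dotProduct, dotProduct_smul,
      dotProduct_comm Q P, hP, hQ, hPQ, smul_eq_mul]
    ring
  · simp only [dotProduct_sub, dotProduct_smul, dotProduct_comm Q P, hQ, hPQ, smul_eq_mul]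
    ring
  · have h2 := hf' y (x - 2 * y)
    push_cast at h2
    rw [show A + (x : ℂ) • v + (y : ℂ) • w =
      A + (y : ℂ) • ((2 : ℂ) • v + w) + ((x : ℂ) - 2 * y) • v by module, h2]
    module

theorem preservesPhi_neg_one (hn : 2 ≤ n) (hf : Continuous f) (h1 : PreservesPhi f 1) :
    PreservesPhi f (-1) := by
  intro X Y hXY
  let i : Fin n := ⟨0, by omega⟩
  let j : Fin n := ⟨1, by omega⟩
  have hij : i ≠ j := by simp [i, j, Fin.ext_iff]
  rw [phi_eq_dotProduct] at hXY
  have hI : (Pi.single j Complex.I : Fin n → ℂ) ⬝ᵥ Pi.single j Complex.I = -1 := by simp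
  obtain ⟨M, hM, hMv⟩ := exists_orthogonal_mulVec_eq
    (v := Pi.single j Complex.I) (w := X - Y) (by rw [hI]; norm_num) (by rw [hI, hXY])
  obtain ⟨p, q, hq, -, hpq⟩ := exists_lorentz_plane_map hn hf h1 (a := 1)
    (v := M *ᵥ Pi.single i 1) (w := X - Y) one_pos
    (by rw [mulVec_dotProduct_mulVec_of_orthogonal hM]; simp) (by rw [hXY]; simp)
    (by rw [← hMv, mulVec_dotProduct_mulVec_of_orthogonal hM]; simp [hij]) Y
  have h2 := hpq 0 1
  simp at h2
  rw [phi_eq_dotProduct, h2, add_sub_cancel_left, hq]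
  simp

/-- A continuous map preserving `1` is real-affine in the imaginary directions. -/
theorem exists_orthogonal_eq_on_imaginary (hn : 2 ≤ n) (hf : Continuous f)
    (h1 : PreservesPhi f 1) (A : Fin n → ℂ) :
    ∃ H : Matrix (Fin n) (Fin n) ℂ, Hᵀ * H = 1 ∧
      ∀ y : Fin n → ℝ, f (A + Complex.I • realVec y) = f A + Complex.I • (H *ᵥ realVec y) := by
  have hI := Complex.I_ne_zero
  have h2 : PreservesPhi (fun X => f (A + X)) (-1) := by
    simpa using (preservesPhi_neg_one hn hf h1).comp_rigid (M := 1) (by simp) A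
  obtain ⟨H, hH, hHf⟩ := exists_orthogonal_eq_on_real hn
    (f := fun X => Complex.I⁻¹ • f (A + Complex.I • X)) (by fun_prop)
    (PreservesPhi.rescale (f := fun X => f (A + X)) hI (by simpa using h2))
  refine ⟨H, hH, fun y => ?_⟩
  have h3 := congrArg (fun Z => Complex.I • Z) (hHf y)
  simp only [smul_add, smul_zero, add_zero, smul_smul, mul_inv_cancel₀ hI, one_smul] at h3
  exact h3

end RealForm

/-! ### The biaffine form and the nonreal value. -/

section TwoDistances

variable {n : ℕ} {f : (Fin n → ℂ) → (Fin n → ℂ)}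

/-- A continuous map preserving `1` is a real-affine map up to the term `(∑ i, x i * y i) • D`,
and its real-linear part maps `Pi.single j 1` and `Pi.single j I` to the columns of `G` and of
`I • H`, where `Gᵀ * H` is scalar. -/
theorem exists_biaffine_form (hn : 2 ≤ n) (hf : Continuous f) (h1 : PreservesPhi f 1) :
    ∃ (G H : Matrix (Fin n) (Fin n) ℂ) (D : Fin n → ℂ) (β : ℂ),
      Gᵀ * G = 1 ∧ Hᵀ * H = 1 ∧ Gᵀ * H = β • 1 ∧
      ∀ x y : Fin n → ℝ, f (realVec x + Complex.I • realVec y) =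
        f 0 + G *ᵥ realVec x + Complex.I • (H *ᵥ realVec y) + (∑ i, (x i * y i : ℂ)) • D := by
  have hI := Complex.I_ne_zero
  let i₀ : Fin n := ⟨0, by omega⟩
  have hs : ∀ i : Fin n, realVec (Pi.single i 1) = Pi.single i 1 := fun i => by
    rw [realVec_single, Complex.ofReal_one]
  obtain ⟨G, hG, hGf⟩ := exists_orthogonal_eq_on_real hn hf h1
  choose H hH hHf using exists_orthogonal_eq_on_imaginary hn hf h1
  have hR : ∀ A : Fin n → ℂ, ∃ K : Matrix (Fin n) (Fin n) ℂ, ∀ x : Fin n → ℝ,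
      f (A + realVec x) = f A + K *ᵥ realVec x := by
    intro A
    obtain ⟨K, -, hK⟩ := exists_orthogonal_eq_on_real hn (f := fun X => f (A + X))
      (by fun_prop) (by simpa using h1.comp_rigid (M := 1) (by simp) A)
    exact ⟨K, fun x => by simpa using hK x⟩
  choose K hK using hR
  have hH0 : ∀ y : Fin n → ℝ,
      f (Complex.I • realVec y) = f 0 + Complex.I • (H 0 *ᵥ realVec y) := fun y => by
    simpa using hHf 0 y
  -- the two ways of reaching a point along a real and an imaginary direction
  have hswap : ∀ x y : Fin n → ℝ,
      K (Complex.I • realVec y) *ᵥ realVec x = G *ᵥ realVec x +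
        Complex.I • ((H (realVec x) - H 0) *ᵥ realVec y) := by
    intro x y
    have e1 := hK (Complex.I • realVec y) x
    have e2 := hHf (realVec x) y
    rw [add_comm, e2, hGf, hH0] at e1
    rw [sub_mulVec, smul_sub]
    linear_combination (exp := 1) -e1
  let D : Fin n → Fin n → Fin n → ℂ := fun j k =>
    Complex.I • ((H (Pi.single j 1) - H 0) *ᵥ Pi.single k 1)
  have hsum : ∀ x : Fin n → ℝ, realVec x = ∑ j, (x j : ℂ) • Pi.single j (1 : ℂ) := fun x => by
    ext i
    simp [realVec, Finset.sum_apply, Pi.single_apply]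
  -- `K (I • y) x` is linear in `x` because `K` is a matrix, and affine in `y` by `hswap`; so the
  -- mixed term is bilinear.
  have hform : ∀ x y : Fin n → ℝ, f (realVec x + Complex.I • realVec y) =
      f 0 + G *ᵥ realVec x + Complex.I • (H 0 *ᵥ realVec y) +
        ∑ j, ∑ k, (x j * y k : ℂ) • D j k := by
    intro x y
    have e1 : ∀ j, K (Complex.I • realVec y) *ᵥ Pi.single j 1 = G *ᵥ Pi.single j 1 +
        ∑ k, (y k : ℂ) • D j k := by
      intro j
      have := hswap (Pi.single j 1) y
      rw [hs] at this
      rw [this]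
      congr 1
      rw [hsum y, mulVec_sum, Finset.smul_sum]
      refine Finset.sum_congr rfl fun k _ => ?_
      rw [mulVec_smul, smul_comm]
    have e2 : K (Complex.I • realVec y) *ᵥ realVec x = G *ᵥ realVec x +
        ∑ j, ∑ k, (x j * y k : ℂ) • D j k := by
      rw [hsum x, mulVec_sum, mulVec_sum, ← Finset.sum_add_distrib]
      refine Finset.sum_congr rfl fun j _ => ?_
      rw [mulVec_smul, mulVec_smul, e1, smul_add, Finset.smul_sum]
      simp only [smul_smul]
    rw [add_comm, hK, e2, hH0]
    abel
  -- For orthogonal `x`, `y` of equal length, `x` and `I • y` span a Lorentzian plane; affinity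
  -- there kills the mixed term.
  have hplane : ∀ (x y : Fin n → ℝ) (a : ℝ), 0 < a → realVec x ⬝ᵥ realVec x = a →
      realVec y ⬝ᵥ realVec y = a → realVec x ⬝ᵥ realVec y = 0 →
      (G *ᵥ realVec x) ⬝ᵥ (H 0 *ᵥ realVec y) = 0 ∧
        ∑ j, ∑ k, (x j * y k : ℂ) • D j k = 0 := by
    intro x y a ha hx hy hxy
    obtain ⟨p, q, -, hpq, hfpq⟩ := exists_lorentz_plane_map hn hf h1 ha hx
      (w := Complex.I • realVec y)
      (by rw [smul_dotProduct, dotProduct_smul, hy, smul_eq_mul, smul_eq_mul, ← mul_assoc,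
        Complex.I_mul_I, neg_one_mul])
      (by rw [dotProduct_smul, hxy, smul_zero]) 0
    have e1 := hfpq 1 0
    have e2 := hfpq 0 1
    have e3 := hfpq 1 1
    simp only [Complex.ofReal_one, Complex.ofReal_zero, one_smul, zero_smul, zero_add,
      add_zero] at e1 e2 e3
    rw [hGf] at e1
    rw [hH0] at e2
    have hp := add_left_cancel e1
    have hq := add_left_cancel e2
    constructor
    · rw [← hp, ← hq, dotProduct_smul, smul_eq_mul] at hpq
      exact (mul_eq_zero.1 hpq).resolve_left hI
    · rw [hform, hp, hq] at e3
      simpa using e3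
  have hoff : ∀ j k, j ≠ k →
      (G *ᵥ Pi.single j 1) ⬝ᵥ (H 0 *ᵥ Pi.single k 1) = 0 ∧ D j k = 0 := by
    intro j k hjk
    have h2 := hplane (Pi.single j 1) (Pi.single k 1) 1 one_pos (by simp [hs]) (by simp [hs])
      (by simp [hs, hjk])
    rw [hs, hs] at h2
    refine ⟨h2.1, ?_⟩
    have h3 := h2.2
    rw [Finset.sum_eq_single j (fun j' _ hj' => by simp [hj']) (by simp),
      Finset.sum_eq_single k (fun k' _ hk' => by simp [hk']) (by simp)] at h3
    simpa using h3
  have hDsum : ∀ x y : Fin n → ℝ, ∑ j, ∑ k, (x j * y k : ℂ) • D j k =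
      ∑ j, (x j * y j : ℂ) • D j j := fun x y =>
    Finset.sum_congr rfl fun j _ => Finset.sum_eq_single j
      (fun k _ hk => by rw [(hoff j k hk.symm).2, smul_zero]) (by simp)
  have hdiag : ∀ j, (G *ᵥ Pi.single j 1) ⬝ᵥ (H 0 *ᵥ Pi.single j 1) =
      (G *ᵥ Pi.single i₀ 1) ⬝ᵥ (H 0 *ᵥ Pi.single i₀ 1) ∧ D j j = D i₀ i₀ := by
    intro j
    rcases eq_or_ne j i₀ with rfl | hj
    · exact ⟨rfl, rfl⟩
    -- This orthogonal pair compares two diagonal entries: its mixed term is `D j j - D i₀ i₀`.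
    have h2 := hplane (Pi.single j 1 + Pi.single i₀ 1) (Pi.single j 1 - Pi.single i₀ 1) 2 two_pos
      (by simp [realVec_add, hs, hj, hj.symm]; norm_num)
      (by simp [realVec_sub, hs, hj, hj.symm]; norm_num)
      (by simp [realVec_add, realVec_sub, hs, hj, hj.symm])
    rw [hDsum, realVec_add, realVec_sub, hs, hs, mulVec_add, mulVec_sub] at h2
    simp only [add_dotProduct, dotProduct_sub, (hoff j i₀ hj).1, (hoff i₀ j hj.symm).1] at h2
    refine ⟨by linear_combination h2.1, ?_⟩
    have h3 := h2.2
    rw [Finset.sum_eq_add j i₀ hj (fun k _ hk => by simp [hk.1, hk.2]) (by simp) (by simp)] at h3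
    simp [hj, hj.symm] at h3
    exact add_neg_eq_zero.1 h3
  refine ⟨G, H 0, D i₀ i₀, (G *ᵥ Pi.single i₀ 1) ⬝ᵥ (H 0 *ᵥ Pi.single i₀ 1), hG, hH 0, ?_,
    fun x y => ?_⟩
  · ext j k
    have h2 : (Gᵀ * H 0) j k = (G *ᵥ Pi.single j 1) ⬝ᵥ (H 0 *ᵥ Pi.single k 1) := by
      simp [Matrix.mul_apply, dotProduct]
    rw [h2]
    rcases eq_or_ne j k with rfl | hjk
    · rw [(hdiag j).1, Matrix.smul_apply, Matrix.one_apply_eq, smul_eq_mul, mul_one]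
    · rw [(hoff j k hjk).1, Matrix.smul_apply, Matrix.one_apply_ne hjk, smul_zero]
  · rw [hform, hDsum, Finset.sum_smul]
    congr 1
    exact Finset.sum_congr rfl fun j _ => by rw [(hdiag j).2]

/-- A continuous map preserving `1` and a nonreal value `σ ^ 2` is complex-affine with orthogonal
linear part. -/
theorem exists_orthogonal_of_preservesPhi_nonreal (hn : 2 ≤ n) (hf : Continuous f)
    (h1 : PreservesPhi f 1) {σ : ℂ} (hσ : (σ ^ 2).im ≠ 0) (h2 : PreservesPhi f (σ ^ 2)) :
    ∃ G : Matrix (Fin n) (Fin n) ℂ, Gᵀ * G = 1 ∧ ∀ X, f X = f 0 + G *ᵥ X := by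
  obtain ⟨G, H, D, β, hG, hH, hGH, hform⟩ := exists_biaffine_form hn hf h1
  let i : Fin n := ⟨0, by omega⟩
  have hσ0 : σ ≠ 0 := by rintro rfl; simp at hσ
  have hri : (σ.re : ℂ) * σ.im ≠ 0 := by
    intro h
    apply hσ
    have : σ.re * σ.im = 0 := by exact_mod_cast h
    simp [sq]
    linarith
  have hdec : σ = σ.re + Complex.I * σ.im := by rw [mul_comm, Complex.re_add_im]
  have hHG : H = β • G := by
    have h3 := congrArg (fun Z => G * Z) hGH
    simp only [← Matrix.mul_assoc, mul_eq_one_comm.1 hG, Matrix.one_mul, Matrix.mul_smul,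
      Matrix.mul_one] at h3
    exact h3
  have hline : ∀ t : ℝ, f ((t * σ) • Pi.single i 1) = f 0 +
      (t * (σ.re + Complex.I * (β * σ.im)) : ℂ) • G *ᵥ Pi.single i 1 +
        (t ^ 2 * (σ.re * σ.im) : ℂ) • D := by
    intro t
    have h3 := hform (Pi.single i (t * σ.re)) (Pi.single i (t * σ.im))
    have h4 : ∀ r : ℝ, realVec (Pi.single i r) = (r : ℂ) • (Pi.single i 1 : Fin n → ℂ) := by
      intro r
      rw [realVec_single, ← Pi.single_smul, smul_eq_mul, mul_one]
    have h5 : ∑ k, (((Pi.single i (t * σ.re) : Fin n → ℝ) k : ℂ) *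
        ((Pi.single i (t * σ.im) : Fin n → ℝ) k : ℂ)) = t ^ 2 * (σ.re * σ.im) := by
      rw [Finset.sum_eq_single i (fun k _ hk => by simp [hk]) (by simp)]
      simp
      ring
    rw [h5, h4, h4, smul_smul, ← add_smul, hHG, mulVec_smul, mulVec_smul, smul_mulVec] at h3
    have h6 : (t * σ : ℂ) = ((t * σ.re : ℝ) : ℂ) + Complex.I * ((t * σ.im : ℝ) : ℂ) := by
      conv_lhs => rw [hdec]
      push_cast
      ring
    rw [h6, h3]
    push_cast
    module
  obtain ⟨p, -, hp⟩ := exists_line_map hn (f := fun X => σ⁻¹ • f (σ • X)) (by fun_prop)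
    (PreservesPhi.rescale hσ0 (by simpa using h2)) (v := Pi.single i 1) (a := 1) one_pos
    (by simp) 0
  -- Conjugating by `σ` makes `f` affine along the real line through `σ • Pi.single i 1`; comparing
  -- `t = 1` and `t = 2` isolates the quadratic term of `hline`.
  have hD : D = 0 := by
    have hp' : ∀ t : ℝ, f ((t * σ) • Pi.single i 1) = f 0 + (t : ℂ) • σ • p := by
      intro t
      have h3 := congrArg (fun Z => σ • Z) (hp t)
      simp only [zero_add, smul_zero, smul_add, smul_smul, mul_inv_cancel₀ hσ0, one_smul] at h3
      rw [mul_comm, h3, smul_smul, mul_comm σ]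
    have e1 := (hline 1).symm.trans (hp' 1)
    have e2 := (hline 2).symm.trans (hp' 2)
    ext k
    have k1 := congrFun e1 k
    have k2 := congrFun e2 k
    simp only [Pi.add_apply, Pi.smul_apply, smul_eq_mul, Complex.ofReal_one,
      Complex.ofReal_ofNat] at k1 k2
    have h3 : (σ.re * σ.im : ℂ) * D k = 0 := by linear_combination (k2 - 2 * k1) / 2
    exact (mul_eq_zero.1 h3).resolve_left hri
  have hβ2 : β ^ 2 = 1 := by
    rw [hHG] at hH
    have h4 := congrFun (congrFun hH i) i
    rw [transpose_smul, Matrix.smul_mul, Matrix.mul_smul, hG] at h4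
    simp at h4
    linear_combination h4
  -- The case `β = -1` is conjugation, which would send `σ ^ 2` to its conjugate.
  have hβ : β = 1 := by
    have h3 := hline 1
    simp only [Complex.ofReal_one, one_mul, hD, smul_zero, add_zero] at h3
    have h4 := h2 (σ • Pi.single i 1) 0 (by simp [phi_eq_dotProduct, sq])
    rw [phi_eq_dotProduct, h3, add_sub_cancel_left, smul_dotProduct, dotProduct_smul,
      mulVec_dotProduct_mulVec_of_orthogonal hG, dotProduct_single, Pi.single_eq_same] at h4
    simp only [smul_eq_mul, mul_one] at h4
    have h5 : σ ^ 2 = (σ.re + Complex.I * σ.im) ^ 2 := by rw [← hdec]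
    rw [h5] at h4
    have h6 : (σ.re * σ.im : ℂ) * (2 * Complex.I * (β - 1)) = 0 := by
      linear_combination h4 - Complex.I ^ 2 * σ.im ^ 2 * hβ2
    have h7 := (mul_eq_zero.1 h6).resolve_left hri
    have h8 := (mul_eq_zero.1 h7).resolve_left (mul_ne_zero two_ne_zero Complex.I_ne_zero)
    exact sub_eq_zero.1 h8
  refine ⟨G, hG, fun X => ?_⟩
  have hX : X = realVec (fun i => (X i).re) + Complex.I • realVec (fun i => (X i).im) := by
    ext k
    simp [realVec, mul_comm Complex.I, Complex.re_add_im]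
  have h3 := hform (fun i => (X i).re) (fun i => (X i).im)
  rw [hHG, hβ, one_smul, hD, smul_zero, add_zero, add_assoc, ← mulVec_smul, ← mulVec_add,
    ← hX] at h3
  exact h3

end TwoDistances

theorem mainTheorem7 (n : ℕ) (hn : 2 ≤ n) (d₁ d₂ : ℂ) (hd₁ : d₁ ≠ 0) (hd₂ : d₂ ≠ 0)
    (hd : ¬ ∃ r : ℝ, d₁ ^ 2 / d₂ ^ 2 = (r : ℂ))
    (f : (Fin n → ℂ) → (Fin n → ℂ)) (hf : Continuous f)
    (h₁ : PreservesDistance f d₁) (h₂ : PreservesDistance f d₂) :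
    IsAffineWithOrthogonalLinearPart f := by
  have hτ : ((d₁ / d₂) ^ 2).im ≠ 0 := fun h =>
    hd ⟨((d₁ / d₂) ^ 2).re, by rw [← div_pow]; exact Complex.ext rfl (by simpa using h)⟩
  have e₁ : d₂ ^ 2 * (d₁ / d₂) ^ 2 = d₁ ^ 2 := by field_simp
  obtain ⟨G, hG, hGf⟩ := exists_orthogonal_of_preservesPhi_nonreal hn
    (f := fun X => d₂⁻¹ • f (d₂ • X)) (by fun_prop)
    (PreservesPhi.rescale hd₂ (by rw [mul_one]; exact h₂)) hτ
    (PreservesPhi.rescale hd₂ (by rw [e₁]; exact h₁))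
  refine ⟨(Matrix.toLin' G).toAffineMap + AffineMap.const ℂ _ (f 0), fun X => ?_, ?_⟩
  · have h3 := congrArg (fun Z => d₂ • Z) (hGf (d₂⁻¹ • X))
    simp only [smul_add, smul_zero, smul_smul, mul_inv_cancel₀ hd₂, one_smul, mulVec_smul] at h3
    rw [h3]
    simp [add_comm]
  · have h4 : ((Matrix.toLin' G).toAffineMap + AffineMap.const ℂ (Fin n → ℂ) (f 0)).linear =
        Matrix.toLin' G := by
      simp
    rw [IsOrthogonalMap, h4, LinearMap.toMatrix'_toLin', mem_orthogonalGroup_iff']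
    exact hG
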